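/- Let $k\in\mathbb N$, and for every $n\ge k$ let $\mathcal F_n$ be a probability distribution on $\{0,1\}^n$. For $n\ge k$ and $1\le i\le n$ let $P_{n,i},P^*_{n,i}:(0,1)\to[0,1]$ be two triangular sequences of item response functions (IRFs). Suppose that each of the two sequences, with its own latent traits, responses and constants, satisfies the following conditions (stated for $P$). 1. (Model, unidimensionality and local independence) For every $n\ge k$ there are, on some probability space, a real-valued latent trait $\Theta_n$ and a response vector $Y_n=(Y_{n,1},\dots,Y_{n,n})\in\{0,1\}^n$ such that $Y_{n,1},\dots,Y_{n,n}$ are mutually independent conditionally on $\Theta_n$, $P(Y_{n,i}=1\mid\Theta_n=\theta)=P_{n,i}(\theta)$ for all $i$ and almost every $\theta\in(0,1)$, and $Y_n$ has distribution $\mathcal F_n$ (the same $\mathcal F_n$ for both sequences). 2. $\Theta_n$ is uniformly distributed on $(0,1)$. 3. Each $P_{n,i}$ is continuously differentiable on $(0,1)$, and for all $0<\alpha<\beta<1$ there are constants $0<m_{\alpha\beta}<M_{\alpha\beta}<\infty$, independent of $(n,i)$, such that $m_{\alpha\beta}<P_{n,i}'(\theta)<M_{\alpha\beta}$ for all $\theta\in[\alpha,\beta]$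 and all $(n,i)$. 4. There are constants $0\le\kappa_{n,i}<\gamma_{n,i}\le 1$ with $P_{n,i}(\theta)\in[\kappa_{n,i},\gamma_{n,i}]$ for all $\theta\in(0,1)$, and for every $\epsilon>0$ there are $l_\epsilon,u_\epsilon\in(0,1)$, independent of $(n,i)$, such that for all $(n,i)$ $$\sup_{\theta\in(0,l_\epsilon]}[P_{n,i}(\theta)-\kappa_{n,i}]\le\epsilon\quad\text{and}\quad\sup_{\theta\in[u_\epsilon,1)}[\gamma_{n,i}-P_{n,i}(\theta)]\le\epsilon .$$ Then $$\lim_{n\to\infty}\ \max_{1\le i\le n}\ \sup_{\theta\in(0,1)}\left|P_{n,i}(\theta)-P^*_{n,i}(\theta)\right|=0 .$$ -/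

import Mathlib

open Set Filter Topology MeasureTheory ProbabilityTheory

/-- `IsIRTModel μ Θ Y P`: on the probability space `(Ω, μ)`, the scalar latent trait `Θ` and the
`n` dichotomous responses `Y ω = (Y ω 1, …, Y ω n)` (`true` is the response `1`) form a
unidimensional, locally independent item response model with item response functions `P`.
`condDistrib Y Θ μ θ` is the conditional law of the response vector given `Θ = θ`. -/
structure IsIRTModel {Ω : Type*} [MeasurableSpace Ω] (μ : Measure Ω) [IsProbabilityMeasure μ]
    {n : ℕ} (Θ : Ω → ℝ) (Y : Ω → Fin n → Bool) (P : Fin n → ℝ → ℝ) : Prop where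
  /-- `Θ` is a scalar random variable. -/
  measurable_trait : Measurable Θ
  /-- The responses are random variables. -/
  measurable_response : Measurable Y
  /-- Local independence: given `Θ`, the responses are mutually independent. -/
  local_indep : ∀ᵐ θ ∂(μ.map Θ),
    iIndepFun (fun (i : Fin n) (y : Fin n → Bool) => y i) (condDistrib Y Θ μ θ)
  /-- `P i θ` is the conditional probability of the response `1` to item `i` given `Θ = θ`. -/
  irf : ∀ i, ∀ᵐ θ ∂(μ.map Θ), (condDistrib Y Θ μ θ).real {y | y i = true} = P i θ

/-- Derivative condition for a triangular sequence `P n i`, `n ≥ k`, of item response functions: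
each of them is `C¹` on `(0,1)`, and on every `[α, β] ⊆ (0,1)` the derivatives lie between two
positive constants that do not depend on `(n, i)`. -/
structure DerivBounded (k : ℕ) (P : (n : ℕ) → Fin n → ℝ → ℝ) : Prop where
  differentiable : ∀ n, k ≤ n → ∀ i : Fin n, DifferentiableOn ℝ (P n i) (Ioo 0 1)
  continuous_deriv : ∀ n, k ≤ n → ∀ i : Fin n, ContinuousOn (deriv (P n i)) (Ioo 0 1)
  bounds : ∀ α β : ℝ, 0 < α → α < β → β < 1 → ∃ m M : ℝ, 0 < m ∧
    ∀ n, k ≤ n → ∀ i : Fin n, ∀ θ ∈ Icc α β, m < deriv (P n i) θ ∧ deriv (P n i) θ < M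

/-- Tail condition for a triangular sequence `P n i`, `n ≥ k`, of item response functions: each of
them takes values in an interval `[κ n i, γ n i] ⊆ [0,1]`, and it approaches `κ n i` at `0` and
`γ n i` at `1` uniformly in `(n, i)`. -/
def TailsUniform (k : ℕ) (P : (n : ℕ) → Fin n → ℝ → ℝ) : Prop :=
  ∃ κ γ : (n : ℕ) → Fin n → ℝ,
    (∀ n, k ≤ n → ∀ i : Fin n, 0 ≤ κ n i ∧ κ n i < γ n i ∧ γ n i ≤ 1 ∧
      ∀ θ ∈ Ioo (0 : ℝ) 1, P n i θ ∈ Icc (κ n i) (γ n i)) ∧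
    ∀ ε : ℝ, 0 < ε → ∃ l ∈ Ioo (0 : ℝ) 1, ∃ u ∈ Ioo (0 : ℝ) 1,
      ∀ n, k ≤ n → ∀ i : Fin n,
        (∀ θ ∈ Ioc 0 l, P n i θ - κ n i ≤ ε) ∧ (∀ θ ∈ Ico u 1, γ n i - P n i θ ≤ ε)

/-! Given the trait, the responses are independent, so the mean score lies within `1 / √n` in `L¹`
of the mean response function `A`. Hence for every `1`-Lipschitz `f` the manifest distribution
determines `∫ f(A)` and `∫ P i * f(A)` up to `1 / √n`, and two models of the same responses agree on
these integrals up to `2 / √n` (`IsIRTModel.abs_integral_sub_integral_le`).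

With a uniform trait, the increasing functions `A` and `A'` are quantile functions of nearly equal
laws. Upper slope bounds turn this into pointwise closeness inside `(0,1)`. Next take for `f` a tent
centred at `A t`: lower slope bounds confine both `f ∘ A` and `f ∘ A'` to a short interval around
`t`, where `P i` and `P' i` are almost constant. Comparing the weighted with the unweighted
integrals gives `P i t ≈ P' i t`. The constants depend on neither `n` nor `i`, so closeness is
uniform on compact subintervals; near `0` and `1` the uniformly small oscillation carries it over
from the nearest compact endpoint. -/

/-! ### Recovering functions from Lipschitz test integrals -/

/-- If every `1`-Lipschitz statistic has nearly the same mean under two increasing reparametrizations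
of the uniform law, then these are close at every point where the second one varies slowly. -/
theorem monotone_lt_add_of_integral_lipschitz_close {A B : ℝ → ℝ} {t r ε τ : ℝ}
    (hA : MonotoneOn A (Ioo 0 1)) (hB : MonotoneOn B (Ioo 0 1))
    (hAc : ContinuousOn A (Ioo 0 1)) (hBc : ContinuousOn B (Ioo 0 1))
    (ht : 0 < t) (hr : 0 < r) (htr : t + r < 1) (hε : 0 < ε)
    (hslow : ∀ s ∈ Icc t (t + r), B s ≤ B t + ε / 2)
    (hclose : ∀ f : ℝ → ℝ, LipschitzWith 1 f →
      |(∫ s in Ioo (0 : ℝ) 1, f (A s)) - ∫ s in Ioo (0 : ℝ) 1, f (B s)| ≤ τ)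
    (hτ : τ < r * (ε / 2)) : A t < B t + ε := by
  by_contra! hcon
  -- A ramp from `0` at `B t` to `ε` at `B t + ε`. If `A t ≥ B t + ε`, then `f ∘ B` vanishes left of
  -- `t` and `f ∘ A` is maximal right of it, so `f ∘ A ≥ f ∘ B` throughout and nothing cancels the
  -- gap `ε / 2` on `[t, t + r]`.
  set f : ℝ → ℝ := fun x => max 0 (min (x - B t) ε) with hf
  have hfl : LipschitzWith 1 f := by
    have h1 : LipschitzWith 1 (fun x : ℝ => x - B t) :=
      LipschitzWith.of_dist_le_mul (fun x y => by simp)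
    exact (h1.min_const ε).const_max 0
  have hfb : ∀ x, 0 ≤ f x ∧ f x ≤ ε := fun x => ⟨le_max_left _ _, max_le hε.le (min_le_right _ _)⟩
  have hint : ∀ C : ℝ → ℝ, ContinuousOn C (Ioo 0 1) → IntegrableOn (fun s => f (C s)) (Ioo 0 1) := by
    intro C hC
    refine Integrable.of_bound
      ((hfl.continuous.comp_continuousOn hC).aestronglyMeasurable measurableSet_Ioo) ε ?_
    exact Eventually.of_forall fun s => by
      rw [Real.norm_eq_abs, abs_of_nonneg (hfb _).1]; exact (hfb _).2
  have htm : t ∈ Ioo (0 : ℝ) 1 := ⟨ht, by linarith⟩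
  have hsub : Icc t (t + r) ⊆ Ioo (0 : ℝ) 1 := fun s hs => ⟨by linarith [hs.1], by linarith [hs.2]⟩
  have hnn : ∀ s ∈ Ioo (0 : ℝ) 1, 0 ≤ f (A s) - f (B s) := by
    intro s hs
    rcases le_total s t with h | h
    · have : f (B s) = 0 := by
        have := hB hs htm h
        exact max_eq_left ((min_le_left _ _).trans (by linarith))
      rw [this]; linarith [(hfb (A s)).1]
    · have : f (A s) = ε := by
        have := hA htm hs h
        simp only [hf]
        rw [min_eq_right (by linarith), max_eq_right hε.le]
      rw [this]; linarith [(hfb (B s)).2]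
  have hlow : ∀ s ∈ Icc t (t + r), ε / 2 ≤ f (A s) - f (B s) := by
    intro s hs
    have h1 : f (A s) = ε := by
      have := hA htm (hsub hs) hs.1
      simp only [hf]
      rw [min_eq_right (by linarith), max_eq_right hε.le]
    have h2 : f (B s) ≤ ε / 2 :=
      max_le (by linarith) ((min_le_left _ _).trans (by linarith [hslow s hs]))
    linarith
  have hI := (hint A hAc).sub (hint B hBc)
  have h1 : r * (ε / 2) ≤ ∫ s in Icc t (t + r), (f (A s) - f (B s)) := by
    have := setIntegral_mono_on (μ := volume) (s := Icc t (t + r)) (f := fun _ => ε / 2)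
      (g := fun s => f (A s) - f (B s)) (by simp) (hI.mono_set hsub) measurableSet_Icc hlow
    simpa [hr.le] using this
  have h2 : ∫ s in Icc t (t + r), (f (A s) - f (B s)) ≤ ∫ s in Ioo (0 : ℝ) 1, (f (A s) - f (B s)) :=
    setIntegral_mono_set hI ((ae_restrict_iff' measurableSet_Ioo).2 (Eventually.of_forall hnn))
      hsub.eventuallyLE
  rw [integral_sub (hint A hAc) (hint B hBc)] at h2
  linarith [le_abs_self ((∫ s in Ioo (0 : ℝ) 1, f (A s)) - ∫ s in Ioo (0 : ℝ) 1, f (B s)), hclose f hfl]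

/-- Two functions `p`, `q` are close at `t` if they have nearly the same integrals against
`1`-Lipschitz functions of two increasing functions `A`, `B` that are close at `t`. -/
theorem sub_le_of_integral_mul_lipschitz_close {A B p q : ℝ → ℝ} {t r ρ δ ε τ : ℝ}
    (hA : MonotoneOn A (Ioo 0 1)) (hB : MonotoneOn B (Ioo 0 1))
    (hAc : ContinuousOn A (Ioo 0 1)) (hBc : ContinuousOn B (Ioo 0 1))
    (hpc : ContinuousOn p (Ioo 0 1)) (hqc : ContinuousOn q (Ioo 0 1))
    (hp : ∀ s ∈ Ioo (0 : ℝ) 1, p s ∈ Icc (0 : ℝ) 1) (hq : ∀ s ∈ Ioo (0 : ℝ) 1, q s ∈ Icc (0 : ℝ) 1)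
    (hr : 0 < r) (htl : 0 < t - r) (htr : t + r < 1) (hρ : 0 < ρ) (hρ1 : t + ρ < 1)
    (hδ : 0 < δ) (hε : 0 < ε)
    (hAr : A t + 2 * δ ≤ A (t + r)) (hAl : A (t - r) + 2 * δ ≤ A t)
    (hBr : B t + 2 * δ ≤ B (t + r)) (hBl : B (t - r) + 2 * δ ≤ B t)
    (hAB : |A t - B t| ≤ δ)
    (hslow : ∀ s ∈ Icc t (t + ρ), A s ≤ A t + δ / 2)
    (hpt : ∀ s ∈ Icc (t - r) (t + r), p t - ε / 4 ≤ p s)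
    (hqt : ∀ s ∈ Icc (t - r) (t + r), q s ≤ q t + ε / 4)
    (hclose : ∀ f : ℝ → ℝ, LipschitzWith 1 f →
      |(∫ s in Ioo (0 : ℝ) 1, f (A s)) - ∫ s in Ioo (0 : ℝ) 1, f (B s)| ≤ τ)
    (hclose' : ∀ f : ℝ → ℝ, LipschitzWith 1 f →
      |(∫ s in Ioo (0 : ℝ) 1, p s * f (A s)) - ∫ s in Ioo (0 : ℝ) 1, q s * f (B s)| ≤ τ)
    (hτ : 12 * τ < ε * (ρ * δ)) : p t - q t ≤ ε := by
  by_contra! hcon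
  set f : ℝ → ℝ := fun x => max 0 (δ - |x - A t|) with hf
  have hfl : LipschitzWith 1 f := by
    have h1 : LipschitzWith 1 (fun x : ℝ => δ - |x - A t|) := by
      refine LipschitzWith.of_dist_le_mul (fun x y => ?_)
      rw [Real.dist_eq, Real.dist_eq, NNReal.coe_one, one_mul]
      have h := abs_abs_sub_abs_le (y - A t) (x - A t)
      rw [sub_sub_sub_cancel_right, abs_sub_comm y x] at h
      rwa [sub_sub_sub_cancel_left]
    exact h1.const_max 0
  have hf0 : ∀ x, 0 ≤ f x := fun x => le_max_left _ _
  have hf1 : ∀ x, f x ≤ δ := fun x => max_le hδ.le (by linarith [abs_nonneg (x - A t)])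
  have hint : ∀ C : ℝ → ℝ, ContinuousOn C (Ioo 0 1) → IntegrableOn (fun s => f (C s)) (Ioo 0 1) := by
    intro C hC
    refine Integrable.of_bound
      ((hfl.continuous.comp_continuousOn hC).aestronglyMeasurable measurableSet_Ioo) δ ?_
    exact Eventually.of_forall fun s => by
      rw [Real.norm_eq_abs, abs_of_nonneg (hf0 _)]; exact hf1 _
  have hintm : ∀ C g : ℝ → ℝ, ContinuousOn C (Ioo 0 1) → ContinuousOn g (Ioo 0 1) →
      (∀ s ∈ Ioo (0 : ℝ) 1, g s ∈ Icc (0 : ℝ) 1) →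
      IntegrableOn (fun s => g s * f (C s)) (Ioo 0 1) := by
    intro C g hC hg hg1
    refine Integrable.of_bound
      ((hg.mul (hfl.continuous.comp_continuousOn hC)).aestronglyMeasurable measurableSet_Ioo) δ ?_
    refine (ae_restrict_iff' measurableSet_Ioo).2 (Eventually.of_forall fun s hs => ?_)
    have h := hg1 s hs
    rw [Real.norm_eq_abs, abs_of_nonneg (mul_nonneg h.1 (hf0 _))]
    nlinarith [hf1 (C s), hf0 (C s), h.1, h.2]
  have htm : t ∈ Ioo (0 : ℝ) 1 := ⟨by linarith, by linarith⟩
  have hrm : t + r ∈ Ioo (0 : ℝ) 1 := ⟨by linarith, by linarith⟩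
  have hlm : t - r ∈ Ioo (0 : ℝ) 1 := ⟨by linarith, by linarith⟩
  have hsub : Icc t (t + ρ) ⊆ Ioo (0 : ℝ) 1 :=
    fun s hs => ⟨by linarith [hs.1, htm.1], by linarith [hs.2]⟩
  obtain ⟨hAB1, hAB2⟩ := abs_le.1 hAB
  -- Of the margin `2 * δ`, one `δ` is the half-width of the tent and the other absorbs `|A t - B
  -- t|`, so the same support bound serves `A` and `B`.
  have hsupp : ∀ C : ℝ → ℝ, MonotoneOn C (Ioo 0 1) → A t + δ ≤ C (t + r) → C (t - r) + δ ≤ A t →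
      ∀ s ∈ Ioo (0 : ℝ) 1, s ∉ Icc (t - r) (t + r) → f (C s) = 0 := by
    intro C hC hCr hCl s hs hns
    refine max_eq_left ?_
    by_cases h : t - r ≤ s
    · have h2 : t + r ≤ s := by
        by_contra! h3; exact hns ⟨h, h3.le⟩
      have := hC hrm hs h2
      linarith [le_abs_self (C s - A t)]
    · have := hC hs hlm (not_le.1 h).le
      linarith [neg_abs_le (C s - A t)]
  have hpA : (p t - ε / 4) * (∫ s in Ioo (0 : ℝ) 1, f (A s)) ≤ ∫ s in Ioo (0 : ℝ) 1, p s * f (A s) := by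
    rw [← integral_const_mul]
    refine setIntegral_mono_on ((hint A hAc).const_mul _) (hintm A p hAc hpc hp) measurableSet_Ioo ?_
    intro s hs
    by_cases h : s ∈ Icc (t - r) (t + r)
    · exact mul_le_mul_of_nonneg_right (hpt s h) (hf0 _)
    · rw [hsupp A hA (by linarith) (by linarith) s hs h]; simp
  have hqB : ∫ s in Ioo (0 : ℝ) 1, q s * f (B s) ≤ (q t + ε / 4) * ∫ s in Ioo (0 : ℝ) 1, f (B s) := by
    rw [← integral_const_mul]
    refine setIntegral_mono_on (hintm B q hBc hqc hq) ((hint B hBc).const_mul _) measurableSet_Ioo ?_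
    intro s hs
    by_cases h : s ∈ Icc (t - r) (t + r)
    · exact mul_le_mul_of_nonneg_right (hqt s h) (hf0 _)
    · rw [hsupp B hB (by linarith) (by linarith) s hs h]; simp
  have hlow : ρ * (δ / 2) ≤ ∫ s in Ioo (0 : ℝ) 1, f (A s) := by
    have h1 := setIntegral_mono_on (μ := volume) (s := Icc t (t + ρ)) (f := fun _ => δ / 2)
      (g := fun s => f (A s)) (by simp) ((hint A hAc).mono_set hsub) measurableSet_Icc (by
        intro s hs
        refine le_max_of_le_right ?_
        have h2 := hA htm (hsub hs) hs.1
        rw [abs_of_nonneg (by linarith)]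
        linarith [hslow s hs])
    have h2 : ∫ s in Icc t (t + ρ), f (A s) ≤ ∫ s in Ioo (0 : ℝ) 1, f (A s) :=
      setIntegral_mono_set (hint A hAc) (Eventually.of_forall fun s => hf0 _) hsub.eventuallyLE
    have h3 : ρ * (δ / 2) ≤ ∫ s in Icc t (t + ρ), f (A s) := by simpa [hρ.le] using h1
    exact h3.trans h2
  have c1 := (abs_le.1 (hclose f hfl)).1
  have c2 := (abs_le.1 (hclose' f hfl)).2
  have hpt1 := hp t htm
  have hqt1 := hq t htm
  have hτ0 : 0 ≤ τ := (abs_nonneg _).trans (hclose f hfl)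
  generalize (∫ s in Ioo (0 : ℝ) 1, f (A s)) = a at *
  generalize (∫ s in Ioo (0 : ℝ) 1, f (B s)) = b at *
  -- With `a = ∫ f(A)`, the assumed gap gives `(ε / 2) * a ≤ τ + (q t + ε / 4) * τ ≤ 3 * τ`, while
  -- `a ≥ ρ * δ / 2`; this is the source of the factor `12`.
  have hε1 : ε ≤ 1 := by linarith [hpt1.2, hqt1.1]
  have e1 : (q t + ε / 4) * b ≤ (q t + ε / 4) * (a + τ) :=
    mul_le_mul_of_nonneg_left (by linarith) (by linarith [hqt1.1])
  have e2 : (q t + ε / 4) * τ ≤ 2 * τ :=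
    mul_le_mul_of_nonneg_right (by linarith [hqt1.2]) hτ0
  have ha : 0 ≤ a := le_trans (by positivity) hlow
  have e3 : (ε / 2) * a ≤ (p t - ε / 4 - (q t + ε / 4)) * a :=
    mul_le_mul_of_nonneg_right (by linarith) ha
  have e4 : ε / 2 * (ρ * (δ / 2)) ≤ ε / 2 * a := mul_le_mul_of_nonneg_left hlow (by linarith)
  nlinarith

/-! ### Concentration of the mean score -/

/-- The proportion of responses `1`. -/
noncomputable def meanScore {n : ℕ} (y : Fin n → Bool) : ℝ :=
  (∑ i, if y i = true then (1 : ℝ) else 0) / n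

/-- The mean of finitely many functions. -/
noncomputable def meanFun {n : ℕ} (P : Fin n → ℝ → ℝ) (θ : ℝ) : ℝ := (∑ i, P i θ) / n

theorem integral_ite_eq_true {n : ℕ} (Q : Measure (Fin n → Bool)) [IsProbabilityMeasure Q]
    (i : Fin n) : ∫ y, (if y i = true then (1 : ℝ) else 0) ∂Q = Q.real {y | y i = true} := by
  rw [← integral_indicator_one (MeasurableSet.of_discrete)]
  refine integral_congr_ae (Eventually.of_forall fun y => ?_)
  simp [indicator_apply]

/-- The mean score of independent responses is within `1 / √n` of its mean, in `L¹`. -/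
theorem integral_abs_meanScore_sub_le {n : ℕ} (hn : n ≠ 0) (Q : Measure (Fin n → Bool))
    [IsProbabilityMeasure Q] (hQ : iIndepFun (fun (i : Fin n) (y : Fin n → Bool) => y i) Q) :
    ∫ y, |meanScore y - (∑ i, Q.real {y | y i = true}) / n| ∂Q ≤ 1 / √n := by
  have hn' : (0 : ℝ) < n := by positivity
  set X : Fin n → (Fin n → Bool) → ℝ := fun i y => if y i = true then 1 else 0 with hX
  have hmem : ∀ Z : (Fin n → Bool) → ℝ, MemLp Z 2 Q := fun Z => MemLp.of_discrete
  have hmean : ∫ y, meanScore y ∂Q = (∑ i, Q.real {y | y i = true}) / n := by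
    unfold meanScore
    rw [integral_div, integral_finsetSum _ fun i _ => Integrable.of_finite]
    simp_rw [integral_ite_eq_true]
  have hvar1 : Var[∑ i, X i; Q] ≤ n := by
    rw [IndepFun.variance_sum (fun i _ => hmem _)]
    · calc ∑ i, Var[X i; Q] ≤ ∑ _i : Fin n, (1 : ℝ) := by
            refine Finset.sum_le_sum fun i _ => ?_
            refine (variance_le_expectation_sq (hmem _).1).trans ?_
            calc ∫ y, (X i ^ 2) y ∂Q ≤ ∫ _y, (1 : ℝ) ∂Q := by
                  refine integral_mono Integrable.of_finite Integrable.of_finite fun y => ?_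
                  simp only [hX, Pi.pow_apply]; split_ifs <;> norm_num
              _ = 1 := by simp
        _ = n := by simp
    · intro i _ j _ hij
      exact (hQ.indepFun hij).comp (φ := fun b => if b = true then (1 : ℝ) else 0)
        (ψ := fun b => if b = true then (1 : ℝ) else 0) (measurable_of_finite _)
        (measurable_of_finite _)
  have hvar : Var[meanScore; Q] ≤ 1 / n := by
    have : (meanScore : (Fin n → Bool) → ℝ) = fun y => (n : ℝ)⁻¹ * (∑ i, X i) y := by
      ext y; simp [meanScore, hX, div_eq_inv_mul]
    rw [this, variance_const_mul]
    calc (n : ℝ)⁻¹ ^ 2 * Var[∑ i, X i; Q] ≤ (n : ℝ)⁻¹ ^ 2 * (n : ℝ) :=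
          mul_le_mul_of_nonneg_left hvar1 (sq_nonneg _)
      _ = 1 / (n : ℝ) := by field_simp
  rw [← hmean]
  set m := ∫ y, meanScore y ∂Q with hm
  -- Nonnegativity of the variance of `|meanScore - m|` is the inequality `(E|meanScore - m|)² ≤ Var
  -- meanScore`.
  have h0 := variance_nonneg (fun y => |meanScore y - m|) Q
  rw [variance_eq_sub (hmem _)] at h0
  have h1 : ∫ y, ((fun y => |meanScore y - m|) ^ 2) y ∂Q = Var[meanScore; Q] := by
    rw [variance_eq_integral (hmem _).1.aemeasurable]
    simp [sq_abs, hm]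
  rw [h1] at h0
  rw [← Real.sqrt_one, ← Real.sqrt_div zero_le_one]
  exact Real.le_sqrt_of_sq_le (by linarith)

/-! ### From manifest distributions to integrals over the trait -/

theorem map_eq_restrict_of_isUniform_Ioo {Ω : Type*} [MeasurableSpace Ω] {μ : Measure Ω}
    {Θ : Ω → ℝ} (hU : pdf.IsUniform Θ (Ioo 0 1) μ) :
    μ.map Θ = volume.restrict (Ioo (0 : ℝ) 1) := by
  rw [hU, ProbabilityTheory.cond]
  simp

namespace IsIRTModel

variable {Ω : Type*} [MeasurableSpace Ω] {μ : Measure Ω} [IsProbabilityMeasure μ] {n : ℕ}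
  {Θ : Ω → ℝ} {Y : Ω → Fin n → Bool} {P : Fin n → ℝ → ℝ}

theorem integral_response_eq (h : IsIRTModel μ Θ Y P) (G : (Fin n → Bool) → ℝ) :
    ∫ y, G y ∂(μ.map Y) = ∫ θ, ∫ y, G y ∂(condDistrib Y Θ μ θ) ∂(μ.map Θ) := by
  have h1 := compProd_map_condDistrib (mβ := Real.measurableSpace) (X := Θ) (Y := Y)
    (μ := μ) h.measurable_response.aemeasurable
  have hG : Measurable G := measurable_of_finite _
  obtain ⟨C, hC⟩ := Finite.exists_le (fun y => ‖G y‖)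
  have : IsProbabilityMeasure (μ.map Θ) :=
    Measure.isProbabilityMeasure_map h.measurable_trait.aemeasurable
  have h2 := Measure.integral_compProd (μ := μ.map Θ) (κ := condDistrib Y Θ μ)
    (f := fun z => G z.2) (Integrable.of_bound (hG.comp measurable_snd).aestronglyMeasurable C
      (Eventually.of_forall fun z => hC z.2))
  have hG2 : Measurable fun z : ℝ × (Fin n → Bool) => G z.2 := hG.comp measurable_snd
  rw [← h2, h1, integral_map (h.measurable_trait.prodMk h.measurable_response).aemeasurable
    hG2.aestronglyMeasurable,
    integral_map h.measurable_response.aemeasurable hG.aestronglyMeasurable]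

/-- Given the trait, Lipschitz functions of the mean score nearly equal the same functions of the
mean response function. -/
theorem abs_integral_mul_meanScore_sub_le (h : IsIRTModel μ Θ Y P) (hn : n ≠ 0)
    (g : (Fin n → Bool) → ℝ) (hg : ∀ y, |g y| ≤ 1) {f : ℝ → ℝ} (hf : LipschitzWith 1 f) :
    ∀ᵐ θ ∂(μ.map Θ), |(∫ y, g y * f (meanScore y) ∂(condDistrib Y Θ μ θ)) -
      (∫ y, g y ∂(condDistrib Y Θ μ θ)) * f (meanFun P θ)| ≤ 1 / √n := by
  filter_upwards [h.local_indep, ae_all_iff.2 h.irf] with θ hθ hP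
  have hmean : (∑ i, (condDistrib Y Θ μ θ).real {y | y i = true}) / n = meanFun P θ := by
    simp_rw [hP]; rfl
  have h1 := integral_abs_meanScore_sub_le hn _ hθ
  rw [hmean] at h1
  rw [← integral_mul_const, ← integral_sub Integrable.of_finite Integrable.of_finite]
  refine (abs_integral_le_integral_abs).trans (le_trans ?_ h1)
  refine integral_mono Integrable.of_finite Integrable.of_finite fun y => ?_
  simp only
  rw [← mul_sub, abs_mul]
  have := hf.dist_le_mul (meanScore y) (meanFun P θ)
  rw [Real.dist_eq, Real.dist_eq, NNReal.coe_one, one_mul] at this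
  calc |g y| * |f (meanScore y) - f (meanFun P θ)| ≤ 1 * |meanScore y - meanFun P θ| := by
        gcongr; exact hg y
    _ = _ := one_mul _

/-- The conditional estimate is integrated over the uniform trait. The function `p` is a continuous
version of the conditional mean of `g`; the cases needed are `g = 1` and `g` the indicator of a
correct response to one item. -/
theorem abs_integral_response_sub_le (h : IsIRTModel μ Θ Y P)
    (hU : pdf.IsUniform Θ (Ioo 0 1) μ) (hn : n ≠ 0) (hP : ∀ i, ContinuousOn (P i) (Ioo 0 1))
    (hP1 : ∀ i, ∀ θ ∈ Ioo (0 : ℝ) 1, P i θ ∈ Icc (0 : ℝ) 1)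
    (g : (Fin n → Bool) → ℝ) (hg : ∀ y, |g y| ≤ 1) {p : ℝ → ℝ} (hpc : ContinuousOn p (Ioo 0 1))
    (hp : ∀ᵐ θ ∂(μ.map Θ), ∫ y, g y ∂(condDistrib Y Θ μ θ) = p θ)
    {f : ℝ → ℝ} (hf : LipschitzWith 1 f) :
    |(∫ y, g y * f (meanScore y) ∂(μ.map Y)) - ∫ θ in Ioo (0 : ℝ) 1, p θ * f (meanFun P θ)|
      ≤ 1 / √n := by
  have hn' : (0 : ℝ) < n := by positivity
  have hae := h.abs_integral_mul_meanScore_sub_le hn g hg hf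
  rw [h.integral_response_eq, map_eq_restrict_of_isUniform_Ioo hU]
  rw [map_eq_restrict_of_isUniform_Ioo hU] at hae hp
  have hgp : ∀ᵐ θ ∂(volume.restrict (Ioo (0 : ℝ) 1)), |p θ| ≤ 1 := by
    filter_upwards [hp] with θ hθ
    rw [← hθ]
    have := norm_integral_le_of_norm_le_const (μ := condDistrib Y Θ μ θ) (f := g) (C := 1)
      (Eventually.of_forall hg)
    simpa using this
  have hc : ContinuousOn (meanFun P) (Ioo 0 1) :=
    (continuousOn_finsetSum _ fun i _ => hP i).div_const _
  have hm1 : ∀ θ ∈ Ioo (0 : ℝ) 1, meanFun P θ ∈ Icc (0 : ℝ) 1 := by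
    intro θ hθ
    refine ⟨div_nonneg (Finset.sum_nonneg fun i _ => (hP1 i θ hθ).1) hn'.le, ?_⟩
    rw [meanFun, div_le_one hn']
    calc ∑ i, P i θ ≤ ∑ _i : Fin n, (1 : ℝ) := Finset.sum_le_sum fun i _ => (hP1 i θ hθ).2
      _ = n := by simp
  obtain ⟨C, hC⟩ := (isCompact_Icc (a := (0 : ℝ)) (b := 1)).exists_bound_of_continuousOn
    hf.continuous.continuousOn
  have hi2 : Integrable (fun θ => p θ * f (meanFun P θ)) (volume.restrict (Ioo (0 : ℝ) 1)) := by
    refine Integrable.of_bound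
      ((hpc.mul (hf.continuous.comp_continuousOn hc)).aestronglyMeasurable measurableSet_Ioo) C ?_
    filter_upwards [hgp, ae_restrict_mem measurableSet_Ioo] with θ h1 h2
    have h3 := hC _ (hm1 θ h2)
    rw [norm_mul, Real.norm_eq_abs]
    nlinarith [norm_nonneg (f (meanFun P θ))]
  have hi1 : Integrable (fun θ => ∫ y, g y * f (meanScore y) ∂(condDistrib Y Θ μ θ))
      (volume.restrict (Ioo (0 : ℝ) 1)) := by
    obtain ⟨D, hD⟩ := Finite.exists_le (fun y : Fin n → Bool => ‖g y * f (meanScore y)‖)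
    refine Integrable.of_bound ((measurable_of_finite _).stronglyMeasurable.integral_kernel (κ := condDistrib Y Θ μ)).aestronglyMeasurable D ?_
    refine Eventually.of_forall fun θ => ?_
    have := norm_integral_le_of_norm_le_const (μ := condDistrib Y Θ μ θ) (Eventually.of_forall hD)
    simpa using this
  rw [← integral_sub hi1 hi2]
  have := norm_integral_le_of_norm_le_const (μ := volume.restrict (Ioo (0 : ℝ) 1)) (C := 1 / √n)
    (f := fun θ => (∫ y, g y * f (meanScore y) ∂(condDistrib Y Θ μ θ)) - p θ * f (meanFun P θ)) (by
      filter_upwards [hae, hp] with θ h1 h2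
      rw [h2] at h1
      exact h1)
  simpa using this

end IsIRTModel

/-- Two models of the same responses have nearly equal integrals against Lipschitz functions of
their mean response functions. -/
theorem IsIRTModel.abs_integral_sub_integral_le {n : ℕ} (hn : n ≠ 0)
    {Ω : Type*} [MeasurableSpace Ω] {μ : Measure Ω} [IsProbabilityMeasure μ]
    {Θ : Ω → ℝ} {Y : Ω → Fin n → Bool} {P : Fin n → ℝ → ℝ}
    {Ω' : Type*} [MeasurableSpace Ω'] {μ' : Measure Ω'} [IsProbabilityMeasure μ']
    {Θ' : Ω' → ℝ} {Y' : Ω' → Fin n → Bool} {P' : Fin n → ℝ → ℝ}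
    (h : IsIRTModel μ Θ Y P) (h' : IsIRTModel μ' Θ' Y' P')
    (hU : pdf.IsUniform Θ (Ioo 0 1) μ) (hU' : pdf.IsUniform Θ' (Ioo 0 1) μ')
    (hY : μ.map Y = μ'.map Y')
    (hP : ∀ i, ContinuousOn (P i) (Ioo 0 1)) (hP' : ∀ i, ContinuousOn (P' i) (Ioo 0 1))
    (hP1 : ∀ i, ∀ θ ∈ Ioo (0 : ℝ) 1, P i θ ∈ Icc (0 : ℝ) 1)
    (hP1' : ∀ i, ∀ θ ∈ Ioo (0 : ℝ) 1, P' i θ ∈ Icc (0 : ℝ) 1)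
    {f : ℝ → ℝ} (hf : LipschitzWith 1 f) :
    |(∫ θ in Ioo (0 : ℝ) 1, f (meanFun P θ)) - ∫ θ in Ioo (0 : ℝ) 1, f (meanFun P' θ)| ≤ 2 / √n ∧
    ∀ i, |(∫ θ in Ioo (0 : ℝ) 1, P i θ * f (meanFun P θ)) -
      ∫ θ in Ioo (0 : ℝ) 1, P' i θ * f (meanFun P' θ)| ≤ 2 / √n := by
  have key : ∀ a b c : ℝ, |a - b| ≤ 1 / √n → |a - c| ≤ 1 / √n → |b - c| ≤ 2 / √n := by
    intro a b c h1 h2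
    rw [abs_sub_comm] at h1
    calc |b - c| ≤ |b - a| + |a - c| := abs_sub_le _ _ _
      _ ≤ 1 / √n + 1 / √n := add_le_add h1 h2
      _ = 2 / √n := by ring
  constructor
  · have h1 := h.abs_integral_response_sub_le hU hn hP hP1 (fun _ => 1) (by simp)
      (p := fun _ => 1) continuousOn_const (by simp) hf
    have h2 := h'.abs_integral_response_sub_le hU' hn hP' hP1' (fun _ => 1) (by simp)
      (p := fun _ => 1) continuousOn_const (by simp) hf
    simp only [one_mul] at h1 h2
    rw [hY] at h1
    exact key _ _ _ h1 h2
  · intro i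
    have hg : ∀ y : Fin n → Bool, |if y i = true then (1 : ℝ) else 0| ≤ 1 := by
      intro y; split_ifs <;> simp
    have h1 := h.abs_integral_response_sub_le hU hn hP hP1 _ hg (hP i)
      (by simpa only [integral_ite_eq_true] using h.irf i) hf
    have h2 := h'.abs_integral_response_sub_le hU' hn hP' hP1' _ hg (hP' i)
      (by simpa only [integral_ite_eq_true] using h'.irf i) hf
    rw [hY] at h1
    exact key _ _ _ h1 h2

/-! ### Uniform slope bounds and compact subintervals -/

theorem DerivBounded.exists_slope_bounds {k : ℕ} {P : (n : ℕ) → Fin n → ℝ → ℝ}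
    (h : DerivBounded k P) {α β : ℝ} (hα : 0 < α) (hαβ : α < β) (hβ : β < 1) :
    ∃ m M : ℝ, 0 < m ∧ 0 < M ∧ ∀ n, k ≤ n → ∀ i : Fin n, ∀ x ∈ Icc α β, ∀ y ∈ Icc α β, x ≤ y →
      m * (y - x) ≤ P n i y - P n i x ∧ P n i y - P n i x ≤ M * (y - x) := by
  obtain ⟨m, M, hm, hb⟩ := h.bounds α β hα hαβ hβ
  -- `DerivBounded` does not state that `M` is positive; the maximum with `1` ensures it.
  refine ⟨m, max M 1, hm, by positivity, fun n hn i x hx y hy hxy => ?_⟩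
  have hsub : Icc α β ⊆ Ioo 0 1 := fun s hs => ⟨hα.trans_le hs.1, hs.2.trans_lt hβ⟩
  have hd := (h.differentiable n hn i).mono hsub
  constructor
  · exact (convex_Icc α β).mul_sub_le_image_sub_of_le_deriv hd.continuousOn
      (hd.mono interior_subset) (fun s hs => (hb n hn i s (interior_subset hs)).1.le) x hx y hy hxy
  · exact (convex_Icc α β).image_sub_le_mul_sub_of_deriv_le hd.continuousOn
      (hd.mono interior_subset)
      (fun s hs => (hb n hn i s (interior_subset hs)).2.le.trans (le_max_left _ _)) x hx y hy hxy

theorem DerivBounded.monotoneOn {k : ℕ} {P : (n : ℕ) → Fin n → ℝ → ℝ}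
    (h : DerivBounded k P) {n : ℕ} (hn : k ≤ n) (i : Fin n) : MonotoneOn (P n i) (Ioo 0 1) := by
  intro x hx y hy hxy
  rcases hxy.eq_or_lt with rfl | hlt
  · exact le_rfl
  obtain ⟨m, M, hm, -, hb⟩ := h.exists_slope_bounds hx.1 hlt hy.2
  have := (hb n hn i x ⟨le_rfl, hxy⟩ y ⟨hxy, le_rfl⟩ hxy).1
  nlinarith

theorem monotoneOn_meanFun {n : ℕ} {P : Fin n → ℝ → ℝ} {s : Set ℝ} (h : ∀ i, MonotoneOn (P i) s) :
    MonotoneOn (meanFun P) s := fun _ hx _ hy hxy =>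
  div_le_div_of_nonneg_right (Finset.sum_le_sum fun i _ => h i hx hy hxy) n.cast_nonneg

theorem continuousOn_meanFun {n : ℕ} {P : Fin n → ℝ → ℝ} {s : Set ℝ}
    (h : ∀ i, ContinuousOn (P i) s) : ContinuousOn (meanFun P) s :=
  (continuousOn_finsetSum _ fun i _ => h i).div_const _

/-- Increment bounds common to all items survive averaging; this is where uniformity of the slope
bounds in `i` enters. -/
theorem meanFun_sub_mem_Icc {n : ℕ} (hn : n ≠ 0) {P : Fin n → ℝ → ℝ} {x y a b : ℝ}
    (h : ∀ i, a ≤ P i y - P i x ∧ P i y - P i x ≤ b) :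
    a ≤ meanFun P y - meanFun P x ∧ meanFun P y - meanFun P x ≤ b := by
  have hn' : (0 : ℝ) < n := by positivity
  rw [meanFun, meanFun, ← sub_div, ← Finset.sum_sub_distrib, le_div_iff₀ hn', div_le_iff₀ hn']
  constructor
  · calc a * n = ∑ _i : Fin n, a := by simp [mul_comm]
      _ ≤ _ := Finset.sum_le_sum fun i _ => (h i).1
  · calc _ ≤ ∑ _i : Fin n, b := Finset.sum_le_sum fun i _ => (h i).2
      _ = b * n := by simp [mul_comm]

/-- Response functions with nearly equal integrals against Lipschitz functions of their means
satisfy an asymptotic one-sided comparison on compact subintervals of `(0,1)`. -/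
theorem DerivBounded.eventually_sub_le {k : ℕ} {P P' : (n : ℕ) → Fin n → ℝ → ℝ}
    (h : DerivBounded k P) (h' : DerivBounded k P')
    (hP1 : ∀ n, k ≤ n → ∀ i, ∀ θ ∈ Ioo (0 : ℝ) 1, P n i θ ∈ Icc (0 : ℝ) 1)
    (hP1' : ∀ n, k ≤ n → ∀ i, ∀ θ ∈ Ioo (0 : ℝ) 1, P' n i θ ∈ Icc (0 : ℝ) 1)
    {τ : ℕ → ℝ} (hτ : Tendsto τ atTop (𝓝 0))
    (hclose : ∀ n, k ≤ n → n ≠ 0 → ∀ f : ℝ → ℝ, LipschitzWith 1 f →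
      |(∫ θ in Ioo (0 : ℝ) 1, f (meanFun (P n) θ)) -
        ∫ θ in Ioo (0 : ℝ) 1, f (meanFun (P' n) θ)| ≤ τ n)
    (hclose' : ∀ n, k ≤ n → n ≠ 0 → ∀ f : ℝ → ℝ, LipschitzWith 1 f → ∀ i,
      |(∫ θ in Ioo (0 : ℝ) 1, P n i θ * f (meanFun (P n) θ)) -
        ∫ θ in Ioo (0 : ℝ) 1, P' n i θ * f (meanFun (P' n) θ)| ≤ τ n)
    {α β ε : ℝ} (hα : 0 < α) (hαβ : α < β) (hβ : β < 1) (hε : 0 < ε) :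
    ∀ᶠ n in atTop, ∀ i, ∀ t ∈ Icc α β, P n i t - P' n i t ≤ ε := by
  -- The interval is enlarged so that `t - r` and `t + r` stay inside it for every `t ∈ [α, β]`.
  obtain ⟨m₁, M₁, hm₁, hM₁, hb₁⟩ := h.exists_slope_bounds (α := α / 2) (β := (1 + β) / 2)
    (by linarith) (by linarith) (by linarith)
  obtain ⟨m₂, M₂, hm₂, hM₂, hb₂⟩ := h'.exists_slope_bounds (α := α / 2) (β := (1 + β) / 2)
    (by linarith) (by linarith) (by linarith)
  obtain ⟨m, hm, hmm₁, hmm₂⟩ : ∃ m, 0 < m ∧ m ≤ m₁ ∧ m ≤ m₂ :=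
    ⟨min m₁ m₂, lt_min hm₁ hm₂, min_le_left _ _, min_le_right _ _⟩
  obtain ⟨M, hM, hMM₁, hMM₂⟩ : ∃ M, 0 < M ∧ M₁ ≤ M ∧ M₂ ≤ M :=
    ⟨max M₁ M₂, lt_max_of_lt_left hM₁, le_max_left _ _, le_max_right _ _⟩
  have hβ0 : 0 < 1 - β := by linarith
  -- Scales fixed before `n`: over length `r` each response function moves by at most `ε / 4` and
  -- each mean by at least `2 * δ`; over length `ρ` each mean moves by at most `δ / 2`.
  obtain ⟨r, hr, hrα, hrβ, hrM⟩ : ∃ r, 0 < r ∧ r ≤ α / 2 ∧ r ≤ (1 - β) / 2 ∧ M * r ≤ ε / 4 := by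
    refine ⟨min (min (α / 2) ((1 - β) / 2)) (ε / (4 * M)), by positivity,
      (min_le_left _ _).trans (min_le_left _ _), (min_le_left _ _).trans (min_le_right _ _), ?_⟩
    calc M * _ ≤ M * (ε / (4 * M)) := by gcongr; exact min_le_right _ _
      _ = ε / 4 := by field_simp
  obtain ⟨δ, hδ, hδr⟩ : ∃ δ, 0 < δ ∧ 2 * δ = m * r := ⟨m * r / 2, by positivity, by ring⟩
  obtain ⟨ρ, hρ, hρr, hρM⟩ : ∃ ρ, 0 < ρ ∧ ρ ≤ r ∧ M * ρ ≤ δ / 2 := by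
    refine ⟨min r (δ / (2 * M)), by positivity, min_le_left _ _, ?_⟩
    calc M * _ ≤ M * (δ / (2 * M)) := by gcongr; exact min_le_right _ _
      _ = δ / 2 := by field_simp
  filter_upwards [eventually_ge_atTop k, eventually_ne_atTop 0,
    hτ.eventually_lt_const (u := ρ * (δ / 2)) (by positivity),
    hτ.eventually_lt_const (u := ε * (ρ * δ) / 12) (by positivity)] with n hn hn0 hτ1 hτ2 i t ht
  have hc : ∀ i, ContinuousOn (P n i) (Ioo 0 1) := fun i => (h.differentiable n hn i).continuousOn
  have hc' : ∀ i, ContinuousOn (P' n i) (Ioo 0 1) :=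
    fun i => (h'.differentiable n hn i).continuousOn
  have hs₁ : ∀ i, ∀ x ∈ Icc (α / 2) ((1 + β) / 2), ∀ y ∈ Icc (α / 2) ((1 + β) / 2), x ≤ y →
      m * (y - x) ≤ P n i y - P n i x ∧ P n i y - P n i x ≤ M * (y - x) := by
    intro i x hx y hy hxy
    have := hb₁ n hn i x hx y hy hxy
    exact ⟨(mul_le_mul_of_nonneg_right hmm₁ (sub_nonneg.2 hxy)).trans this.1,
      this.2.trans (mul_le_mul_of_nonneg_right hMM₁ (sub_nonneg.2 hxy))⟩
  have hs₂ : ∀ i, ∀ x ∈ Icc (α / 2) ((1 + β) / 2), ∀ y ∈ Icc (α / 2) ((1 + β) / 2), x ≤ y →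
      m * (y - x) ≤ P' n i y - P' n i x ∧ P' n i y - P' n i x ≤ M * (y - x) := by
    intro i x hx y hy hxy
    have := hb₂ n hn i x hx y hy hxy
    exact ⟨(mul_le_mul_of_nonneg_right hmm₂ (sub_nonneg.2 hxy)).trans this.1,
      this.2.trans (mul_le_mul_of_nonneg_right hMM₂ (sub_nonneg.2 hxy))⟩
  have hA := monotoneOn_meanFun fun i => h.monotoneOn hn i
  have hB := monotoneOn_meanFun fun i => h'.monotoneOn hn i
  have hAc := continuousOn_meanFun hc
  have hBc := continuousOn_meanFun hc'
  have hmem : ∀ s ∈ Icc (t - r) (t + r), s ∈ Icc (α / 2) ((1 + β) / 2) := fun s hs =>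
    ⟨by linarith [hs.1, ht.1], by linarith [hs.2, ht.2]⟩
  have htm := hmem t ⟨by linarith, by linarith⟩
  have hlm := hmem (t - r) ⟨le_rfl, by linarith⟩
  have hrm := hmem (t + r) ⟨by linarith, le_rfl⟩
  have hAr := (meanFun_sub_mem_Icc hn0 fun i => hs₁ i t htm _ hrm (by linarith)).1
  have hAl := (meanFun_sub_mem_Icc hn0 fun i => hs₁ i _ hlm t htm (by linarith)).1
  have hBr := (meanFun_sub_mem_Icc hn0 fun i => hs₂ i t htm _ hrm (by linarith)).1
  have hBl := (meanFun_sub_mem_Icc hn0 fun i => hs₂ i _ hlm t htm (by linarith)).1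
  rw [add_sub_cancel_left] at hAr hBr
  rw [sub_sub_cancel] at hAl hBl
  have hslow : ∀ s ∈ Icc t (t + ρ), meanFun (P n) s ≤ meanFun (P n) t + δ / 2 := by
    intro s hs
    have := (meanFun_sub_mem_Icc hn0 fun i => hs₁ i t htm s
      (hmem s ⟨by linarith [hs.1], by linarith [hs.2]⟩) hs.1).2
    have h2 : M * (s - t) ≤ M * ρ := mul_le_mul_of_nonneg_left (by linarith [hs.2]) hM.le
    linarith
  have hslow' : ∀ s ∈ Icc t (t + ρ), meanFun (P' n) s ≤ meanFun (P' n) t + δ / 2 := by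
    intro s hs
    have := (meanFun_sub_mem_Icc hn0 fun i => hs₂ i t htm s
      (hmem s ⟨by linarith [hs.1], by linarith [hs.2]⟩) hs.1).2
    have h2 : M * (s - t) ≤ M * ρ := mul_le_mul_of_nonneg_left (by linarith [hs.2]) hM.le
    linarith
  have ht0 : 0 < t := by linarith [ht.1]
  have htρ : t + ρ < 1 := by linarith [ht.2]
  have hAB := monotone_lt_add_of_integral_lipschitz_close hA hB hAc hBc ht0 hρ htρ hδ hslow'
    (hclose n hn hn0) hτ1
  have hBA := monotone_lt_add_of_integral_lipschitz_close hB hA hBc hAc ht0 hρ htρ hδ hslow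
    (fun f hf => by rw [abs_sub_comm]; exact hclose n hn hn0 f hf) hτ1
  refine sub_le_of_integral_mul_lipschitz_close hA hB hAc hBc (hc i) (hc' i) (hP1 n hn i)
    (hP1' n hn i) hr (by linarith [ht.1]) (by linarith [ht.2]) hρ htρ hδ hε (by linarith)
    (by linarith) (by linarith) (by linarith) (abs_le.2 ⟨by linarith, by linarith⟩) hslow ?_ ?_
    (hclose n hn hn0) (fun f hf => hclose' n hn hn0 f hf i) (by linarith)
  · intro s hs
    rcases le_total t s with hts | hst
    · have := (hs₁ i t htm s (hmem s hs) hts).1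
      nlinarith
    · have := (hs₁ i s (hmem s hs) t htm hst).2
      have h2 : M * (t - s) ≤ M * r := mul_le_mul_of_nonneg_left (by linarith [hs.1]) hM.le
      linarith
  · intro s hs
    rcases le_total t s with hts | hst
    · have := (hs₂ i t htm s (hmem s hs) hts).2
      have h2 : M * (s - t) ≤ M * r := mul_le_mul_of_nonneg_left (by linarith [hs.2]) hM.le
      linarith
    · have := (hs₂ i s (hmem s hs) t htm hst).1
      nlinarith

/-! ### Tails and conclusion -/

theorem TailsUniform.mem_Icc {k : ℕ} {P : (n : ℕ) → Fin n → ℝ → ℝ} (h : TailsUniform k P)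
    (n : ℕ) (hn : k ≤ n) (i : Fin n) (θ : ℝ) (hθ : θ ∈ Ioo (0 : ℝ) 1) :
    P n i θ ∈ Icc (0 : ℝ) 1 := by
  obtain ⟨κ, γ, hκγ, -⟩ := h
  obtain ⟨h0, -, h1, h2⟩ := hκγ n hn i
  exact ⟨h0.trans (h2 θ hθ).1, (h2 θ hθ).2.trans h1⟩

/-- Near `0` all values lie in `[κ, κ + ε]`, near `1` in `[γ - ε, γ]`. Passing to oscillations
removes `κ` and `γ`, so the asymptotes of the two models need not be compared. -/
theorem TailsUniform.exists_oscillation_le {k : ℕ} {P : (n : ℕ) → Fin n → ℝ → ℝ}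
    (h : TailsUniform k P) {ε : ℝ} (hε : 0 < ε) :
    ∃ l ∈ Ioo (0 : ℝ) 1, ∃ u ∈ Ioo (0 : ℝ) 1, ∀ n, k ≤ n → ∀ i : Fin n,
      (∀ θ ∈ Ioc 0 l, ∀ θ' ∈ Ioc 0 l, |P n i θ - P n i θ'| ≤ ε) ∧
      (∀ θ ∈ Ico u 1, ∀ θ' ∈ Ico u 1, |P n i θ - P n i θ'| ≤ ε) := by
  obtain ⟨κ, γ, hκγ, ht⟩ := h
  obtain ⟨l, hl, u, hu, hlu⟩ := ht ε hε
  refine ⟨l, hl, u, hu, fun n hn i => ⟨fun θ hθ θ' hθ' => ?_, fun θ hθ θ' hθ' => ?_⟩⟩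
  · obtain ⟨-, -, -, hb⟩ := hκγ n hn i
    have h1 := hb θ ⟨hθ.1, hθ.2.trans_lt hl.2⟩
    have h2 := hb θ' ⟨hθ'.1, hθ'.2.trans_lt hl.2⟩
    have h3 := (hlu n hn i).1 θ hθ
    have h4 := (hlu n hn i).1 θ' hθ'
    exact abs_le.2 ⟨by linarith [h1.1], by linarith [h2.1]⟩
  · obtain ⟨-, -, -, hb⟩ := hκγ n hn i
    have h1 := hb θ ⟨hu.1.trans_le hθ.1, hθ.2⟩
    have h2 := hb θ' ⟨hu.1.trans_le hθ'.1, hθ'.2⟩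
    have h3 := (hlu n hn i).2 θ hθ
    have h4 := (hlu n hn i).2 θ' hθ'
    exact abs_le.2 ⟨by linarith [h2.2], by linarith [h1.2]⟩

theorem theorem1
    -- The triangular sequences start at `k`; `F n` is the manifest distribution of `n` responses.
    (k : ℕ) (F : (n : ℕ) → Measure (Fin n → Bool))
    -- The first sequence of models.
    {Ω : ℕ → Type*} [∀ n, MeasurableSpace (Ω n)]
    (μ : (n : ℕ) → Measure (Ω n)) [∀ n, IsProbabilityMeasure (μ n)]
    (Θ : (n : ℕ) → Ω n → ℝ) (Y : (n : ℕ) → Ω n → Fin n → Bool)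
    (P : (n : ℕ) → Fin n → ℝ → ℝ)
    -- The second sequence of models.
    {Ω' : ℕ → Type*} [∀ n, MeasurableSpace (Ω' n)]
    (μ' : (n : ℕ) → Measure (Ω' n)) [∀ n, IsProbabilityMeasure (μ' n)]
    (Θ' : (n : ℕ) → Ω' n → ℝ) (Y' : (n : ℕ) → Ω' n → Fin n → Bool)
    (P' : (n : ℕ) → Fin n → ℝ → ℝ)
    -- Unidimensionality and local independence.
    (hmodel : ∀ n, k ≤ n → IsIRTModel (μ n) (Θ n) (Y n) (P n))
    (hmodel' : ∀ n, k ≤ n → IsIRTModel (μ' n) (Θ' n) (Y' n) (P' n))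
    -- The latent traits are uniform on `(0,1)`.
    (hunif : ∀ n, k ≤ n → pdf.IsUniform (Θ n) (Ioo 0 1) (μ n))
    (hunif' : ∀ n, k ≤ n → pdf.IsUniform (Θ' n) (Ioo 0 1) (μ' n))
    -- Both are models for the same sequence of manifest distributions.
    (hF : ∀ n, k ≤ n → (μ n).map (Y n) = F n)
    (hF' : ∀ n, k ≤ n → (μ' n).map (Y' n) = F n)
    (hderiv : DerivBounded k P) (hderiv' : DerivBounded k P')
    (htails : TailsUniform k P) (htails' : TailsUniform k P') :
    Tendsto (fun n : ℕ => ⨆ i : Fin n, ⨆ θ : Ioo (0 : ℝ) 1, |P n i θ - P' n i θ|)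
      atTop (𝓝 0) := by
  have hcl := fun n (hn : k ≤ n) (hn0 : n ≠ 0) (f : ℝ → ℝ) (hf : LipschitzWith 1 f) =>
    (hmodel n hn).abs_integral_sub_integral_le hn0 (hmodel' n hn) (hunif n hn) (hunif' n hn)
      ((hF n hn).trans (hF' n hn).symm) (fun i => (hderiv.differentiable n hn i).continuousOn)
      (fun i => (hderiv'.differentiable n hn i).continuousOn) (htails.mem_Icc n hn)
      (htails'.mem_Icc n hn) hf
  have hτ : Tendsto (fun n : ℕ => 2 / √(n : ℝ)) atTop (𝓝 0) :=
    tendsto_const_nhds.div_atTop (Real.tendsto_sqrt_atTop.comp tendsto_natCast_atTop_atTop)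
  have hcompact : ∀ α β ε : ℝ, 0 < α → α < β → β < 1 → 0 < ε →
      ∀ᶠ n in atTop, ∀ i, ∀ t ∈ Icc α β, |P n i t - P' n i t| ≤ ε := by
    intro α β ε hα hαβ hβ hε
    have h1 := hderiv.eventually_sub_le hderiv' htails.mem_Icc htails'.mem_Icc hτ
      (fun n hn hn0 f hf => (hcl n hn hn0 f hf).1)
      (fun n hn hn0 f hf => (hcl n hn hn0 f hf).2) hα hαβ hβ hε
    have h2 := hderiv'.eventually_sub_le hderiv htails'.mem_Icc htails.mem_Icc hτ
      (fun n hn hn0 f hf => by rw [abs_sub_comm]; exact (hcl n hn hn0 f hf).1)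
      (fun n hn hn0 f hf i => by rw [abs_sub_comm]; exact (hcl n hn hn0 f hf).2 i) hα hαβ hβ hε
    filter_upwards [h1, h2] with n h1 h2 i t ht
    exact abs_le.2 ⟨by linarith [h2 i t ht], h1 i t ht⟩
  rw [Metric.tendsto_nhds]
  intro ε hε
  have hε4 : 0 < ε / 4 := by positivity
  obtain ⟨l, hl, u, hu, hosc⟩ := htails.exists_oscillation_le hε4
  obtain ⟨l', hl', u', hu', hosc'⟩ := htails'.exists_oscillation_le hε4
  -- The bounds `1 / 3` here and `2 / 3` below serve only to give `α < β`.
  obtain ⟨α, hα, hα3, hαl, hαl'⟩ : ∃ α : ℝ, 0 < α ∧ α ≤ 1 / 3 ∧ α ≤ l ∧ α ≤ l' :=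
    ⟨min (1 / 3) (min l l'), lt_min (by norm_num) (lt_min hl.1 hl'.1), min_le_left _ _,
      (min_le_right _ _).trans (min_le_left _ _), (min_le_right _ _).trans (min_le_right _ _)⟩
  obtain ⟨β, hβ, hβ3, hβu, hβu'⟩ : ∃ β : ℝ, β < 1 ∧ 2 / 3 ≤ β ∧ u ≤ β ∧ u' ≤ β :=
    ⟨max (2 / 3) (max u u'), max_lt (by norm_num) (max_lt hu.2 hu'.2), le_max_left _ _,
      (le_max_left _ _).trans (le_max_right _ _), (le_max_right _ _).trans (le_max_right _ _)⟩
  have hαβ : α < β := by linarith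
  filter_upwards [eventually_ge_atTop k, hcompact α β (ε / 4) hα hαβ hβ hε4] with n hn hcomp
  have htri : ∀ a b c d : ℝ, |a - b| ≤ ε / 4 → |c - d| ≤ ε / 4 → |b - d| ≤ ε / 4 →
      |a - c| ≤ 3 * (ε / 4) := by
    intro a b c d h1 h2 h3
    rw [abs_le] at *
    constructor <;> linarith
  have hall : ∀ i, ∀ t ∈ Ioo (0 : ℝ) 1, |P n i t - P' n i t| ≤ 3 * (ε / 4) := by
    intro i t ht
    rcases le_total t α with h1 | h1
    · exact htri _ _ _ _
        ((hosc n hn i).1 t ⟨ht.1, h1.trans hαl⟩ α ⟨hα, hαl⟩)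
        ((hosc' n hn i).1 t ⟨ht.1, h1.trans hαl'⟩ α ⟨hα, hαl'⟩) (hcomp i α ⟨le_rfl, hαβ.le⟩)
    rcases le_total t β with h2 | h2
    · linarith [hcomp i t ⟨h1, h2⟩]
    · exact htri _ _ _ _
        ((hosc n hn i).2 t ⟨hβu.trans h2, ht.2⟩ β ⟨hβu, hβ⟩)
        ((hosc' n hn i).2 t ⟨hβu'.trans h2, ht.2⟩ β ⟨hβu', hβ⟩) (hcomp i β ⟨hαβ.le, le_rfl⟩)
  -- `Real.iSup_le` also needs a nonnegative bound, since the real supremum of an empty family is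
  -- `0`.
  have hle : (⨆ i : Fin n, ⨆ θ : Ioo (0 : ℝ) 1, |P n i θ - P' n i θ|) ≤ 3 * (ε / 4) :=
    Real.iSup_le (fun i => Real.iSup_le (fun θ => hall i θ θ.2) (by positivity)) (by positivity)
  have hnn : 0 ≤ ⨆ i : Fin n, ⨆ θ : Ioo (0 : ℝ) 1, |P n i θ - P' n i θ| :=
    Real.iSup_nonneg fun i => Real.iSup_nonneg fun θ => abs_nonneg _
  rw [Real.dist_eq, sub_zero, abs_of_nonneg hnn]
  linarith
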